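/- Let $L$ be a completely regular frame; that is, $L$ is a complete lattice in which $a\wedge\bigvee B=\bigvee_{b\in B}(a\wedge b)$ for all $a\in L$ and $B\subseteq L$, and every $a\in L$ is the join of the elements $b$ that are completely below it. Here $b^*$ denotes the pseudocomplement of $b$, and $b$ is completely below $a$ if there are elements $c_r\in L$ ($r\in\mathbb{Q}\cap[0,1]$) with $b\le c_0$, $c_1\le a$ and $c_r^*\vee c_s=1$ whenever $r<s$. For a frame $M$, let $\mathrm{C}(M)$ be the set of frame homomorphisms $\mathfrak{L}(\mathbb{R})\to M$, where the frame of reals $\mathfrak{L}(\mathbb{R})$ is the frame presented by generators $(p,-)$ and $(-,p)$, $p\in\mathbb{Q}$, subject to the relations $(p,-)\wedge(-,q)=0$ if $p\ge q$; $(p,-)\vee(-,q)=1$ if $p<q$; $(p,-)=\bigvee_{q>p}(q,-)$; $(-,p)=\bigvee_{q<p}(-,q)$; $\bigvee_p(p,-)=1=\bigvee_p(-,p)$. It is a Riesz space (a real vector lattice) under the order $f\le g\iff f(p,-)\le g(p,-)$ for all $p\in\mathbb{Q}$ and the operations $(f+g)(p,-)=\bigvee_{r\in\mathbb{Q}}f(r,-)\wedge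 g(p-r,-)$, $(f+g)(-,q)=\bigvee_{s\in\mathbb{Q}}f(-,s)\wedge g(-,q-s)$ and, for $c\in\mathbb{R}$, $(cf)(p,-)=\bigvee\{f(r,-)\wedge f(-,s)\mid r,s\in\mathbb{Q},\ cr>p,\ cs>p\}$, $(cf)(-,q)=\bigvee\{f(r,-)\wedge f(-,s)\mid r,s\in\mathbb{Q},\ cr<q,\ cs<q\}$. Let $\mathfrak{B}(L)=\{a\in L\mid a=a^{**}\}$ be the Booleanization of $L$, which is a complete Boolean algebra in the order of $L$, let $\beta\colon L\to\mathfrak{B}(L)$ be the frame homomorphism $\beta(a)=a^{**}$, and let $\Upsilon\colon\mathrm{C}(L)\to\mathrm{C}(\mathfrak{B}(L))$ be given by $\Upsilon(f)=\beta\circ f$. Then $(\mathrm{C}(\mathfrak{B}(L)),\Upsilon)$ is the universal completion of the Riesz space $\mathrm{C}(L)$. That is: 1. $\mathrm{C}(\mathfrak{B}(L))$ is universally complete: every nonempty subset that is bounded above has a supremum (Dedekind completeness), and every nonempty set of pairwise disjoint positive elements (i.e. $g\wedge h=0$ for distinct $g,h$ in the set) has a supremum (lateral completeness); 2. $\Upsilon$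 is a Riesz embedding, i.e. an injective linear lattice homomorphism; 3. for every $0\le f\in\mathrm{C}(\mathfrak{B}(L))$, $f=\bigvee\{\Upsilon(g)\mid g\in\mathrm{C}(L),\ 0\le\Upsilon(g)\le f\}$ in $\mathrm{C}(\mathfrak{B}(L))$. -/

import Mathlib

/-! ### Regularity of frames -/

/-- `b ≺ a`: `b` is rather below `a`. -/
def RatherBelow {L : Type*} [Order.Frame L] (b a : L) : Prop := bᶜ ⊔ a = ⊤

/-- `b ≺≺ a`: `b` is completely below `a`, witnessed by a family indexed by `ℚ ∩ [0,1]`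
(only the values of `c` on `[0,1]` matter). -/
def CompletelyBelow {L : Type*} [Order.Frame L] (b a : L) : Prop :=
  ∃ c : ℚ → L, b ≤ c 0 ∧ c 1 ≤ a ∧ ∀ r s : ℚ, 0 ≤ r → r < s → s ≤ 1 → RatherBelow (c r) (c s)

/-- A frame is completely regular if every element is the join of those completely below it. -/
def IsCompletelyRegularFrame (L : Type*) [Order.Frame L] : Prop :=
  ∀ a : L, a = sSup {b : L | CompletelyBelow b a}

/-! ### The Booleanization of a frame -/

/-- The Booleanization of a frame: its regular elements `a = aᶜᶜ`. -/
def Booleanization (L : Type*) [Order.Frame L] : Type _ := Heyting.Regular L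

/-- Meets are computed in `L`, joins are the double pseudocomplements of joins in `L`. -/
instance Booleanization.instCompleteBooleanAlgebra {L : Type*} [Order.Frame L] :
    CompleteBooleanAlgebra (Booleanization L) where
  __ := (inferInstanceAs (BooleanAlgebra (Heyting.Regular L)) :
    BooleanAlgebra (Booleanization L))
  sSup A := ⟨(sSup (Heyting.Regular.val '' A))ᶜᶜ, Heyting.isRegular_compl _⟩
  sInf A := ⟨sInf (Heyting.Regular.val '' A), by
    refine le_antisymm (le_sInf ?_) le_compl_compl
    rintro _ ⟨a, ha, rfl⟩
    calc (sInf (Heyting.Regular.val '' A))ᶜᶜ ≤ (a.val)ᶜᶜ :=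
          compl_le_compl (compl_le_compl (sInf_le ⟨a, ha, rfl⟩))
      _ = a.val := a.prop⟩
  isLUB_sSup A := by
    constructor
    · intro a ha
      exact Heyting.Regular.coe_le_coe.1
        ((le_sSup (Set.mem_image_of_mem Heyting.Regular.val ha)).trans le_compl_compl)
    · intro b hb
      refine Heyting.Regular.coe_le_coe.1 ?_
      calc (sSup (Heyting.Regular.val '' A))ᶜᶜ ≤ (b.val)ᶜᶜ := by
            refine compl_le_compl (compl_le_compl (sSup_le ?_))
            rintro _ ⟨a, ha, rfl⟩
            exact Heyting.Regular.coe_le_coe.2 (hb ha)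
        _ = b.val := b.prop
  isGLB_sInf A := by
    constructor
    · intro a ha
      exact Heyting.Regular.coe_le_coe.1 (sInf_le ⟨a, ha, rfl⟩)
    · intro b hb
      refine Heyting.Regular.coe_le_coe.1 (le_sInf ?_)
      rintro _ ⟨a, ha, rfl⟩
      exact Heyting.Regular.coe_le_coe.2 (hb ha)

/-- The frame homomorphism `β : L → 𝔅(L)`, `a ↦ aᶜᶜ`. -/
def booleanizationHom (L : Type*) [Order.Frame L] : FrameHom L (Booleanization L) where
  toFun a := (Heyting.Regular.toRegular a : Heyting.Regular L)
  map_inf' a b := Heyting.Regular.coe_injective (compl_compl_inf_distrib a b)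
  map_top' := Heyting.Regular.coe_injective (show (⊤ : L)ᶜᶜ = ⊤ by simp)
  map_sSup' A := by
    refine (isLUB_sSup _).unique ?_ |>.symm
    have h := (Heyting.Regular.gi (α := L)).gc.isLUB_l_image (isLUB_sSup A)
    exact h

theorem val_booleanizationHom {L : Type*} [Order.Frame L] (a : L) :
    Heyting.Regular.val (booleanizationHom L a) = aᶜᶜ := rfl

/-! ### Frames presented by generators and relations -/

/-- The free frame on a set `G` of generators: the down-sets of the free meet-semilattice on `G`,
which consists of the finite subsets of `G` ordered by reverse inclusion. -/
abbrev FreeFrame (G : Type*) : Type _ := LowerSet (Finset G)ᵒᵈ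

/-- The generator `g` in the free frame. -/
def FreeFrame.of {G : Type*} (g : G) : FreeFrame G := LowerSet.Iic (OrderDual.toDual {g})

/-- The extension of an assignment of the generators to a frame homomorphism. -/
def FreeFrame.lift {G L : Type*} [Order.Frame L] (φ : G → L) : FrameHom (FreeFrame G) L where
  toFun D := ⨆ s ∈ D, (OrderDual.ofDual s).inf φ
  map_inf' D E := by
    classical
    apply le_antisymm
    · refine iSup₂_le fun s hs => le_inf ?_ ?_
      · exact le_iSup₂_of_le s hs.1 le_rfl
      · exact le_iSup₂_of_le s hs.2 le_rfl
    · rw [iSup_inf_eq]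
      refine iSup_le fun s => ?_
      rw [iSup_inf_eq]
      refine iSup_le fun hs => ?_
      rw [inf_iSup_eq]
      refine iSup_le fun t => ?_
      rw [inf_iSup_eq]
      refine iSup_le fun ht => ?_
      rw [← Finset.inf_union]
      refine le_iSup₂_of_le
        (OrderDual.toDual (OrderDual.ofDual s ∪ OrderDual.ofDual t)) ⟨?_, ?_⟩ le_rfl
      · exact D.lower (show _ ≤ s from Finset.subset_union_left (s₁ := OrderDual.ofDual s)) hs
      · exact E.lower (show _ ≤ t from Finset.subset_union_right (s₁ := OrderDual.ofDual s)) ht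
  map_top' := top_le_iff.1 (le_iSup₂_of_le (OrderDual.toDual ∅) trivial (by simp))
  map_sSup' A := by
    apply le_antisymm
    · refine iSup₂_le fun s hs => ?_
      obtain ⟨D, hD, hsD⟩ := LowerSet.mem_sSup_iff.1 hs
      exact (le_iSup₂_of_le (f := fun s (_ : s ∈ D) => (OrderDual.ofDual s).inf φ)
        s hsD le_rfl).trans (le_sSup ⟨D, hD, rfl⟩)
    · refine sSup_le ?_
      rintro _ ⟨D, hD, rfl⟩
      exact iSup₂_le fun s hs => le_iSup₂_of_le s (LowerSet.mem_sSup_iff.2 ⟨D, hD, hs⟩) le_rfl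

theorem FreeFrame.lift_of {G L : Type*} [Order.Frame L] (φ : G → L) (g : G) :
    FreeFrame.lift φ (FreeFrame.of g) = φ g := by
  change (⨆ s ∈ FreeFrame.of g, (OrderDual.ofDual s).inf φ) = φ g
  apply le_antisymm
  · refine iSup₂_le fun s hs => ?_
    have hs' : ({g} : Finset G) ⊆ OrderDual.ofDual s := hs
    exact Finset.inf_le (hs' (Finset.mem_singleton_self g))
  · exact le_iSup₂_of_le (OrderDual.toDual {g}) (le_refl (OrderDual.toDual ({g} : Finset G)))
      (by simp)

theorem FreeFrame.hom_ext {G L : Type*} [Order.Frame L] {f g : FrameHom (FreeFrame G) L}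
    (h : ∀ x : G, f (FreeFrame.of x) = g (FreeFrame.of x)) : f = g := by
  classical
  have key : ∀ s : Finset G, (LowerSet.Iic (OrderDual.toDual s) : FreeFrame G) =
      s.inf FreeFrame.of := by
    intro s
    induction s using Finset.induction_on with
    | empty =>
      rw [Finset.inf_empty]
      exact top_le_iff.1 fun t _ => Finset.empty_subset (OrderDual.ofDual t)
    | insert a s _ ih =>
      rw [Finset.inf_insert, ← ih]
      ext t
      exact Finset.insert_subset_iff (a := a) (s := s) (t := OrderDual.ofDual t) |>.trans
        (and_congr Finset.singleton_subset_iff.symm Iff.rfl)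
  have hfin : ∀ s : Finset G, f (LowerSet.Iic (OrderDual.toDual s)) =
      g (LowerSet.Iic (OrderDual.toDual s)) := by
    intro s
    rw [key, map_finset_inf, map_finset_inf]
    exact Finset.inf_congr rfl fun x _ => h x
  refine FrameHom.ext fun D => ?_
  have hD : D = ⨆ s ∈ D, LowerSet.Iic s := by
    apply le_antisymm
    · intro s hs
      exact LowerSet.mem_iSup₂_iff.2 ⟨s, hs, le_refl s⟩
    · exact iSup₂_le fun s hs => LowerSet.Iic_le.2 hs
  rw [hD, map_iSup₂, map_iSup₂]
  exact iSup_congr fun s => iSup_congr fun _ => hfin (OrderDual.ofDual s)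

/-- The quotient of the free frame by the relations `x = y`, for `R x y`, as the sublocale of
those elements that do not distinguish `x` from `y`. -/
def presentedSublocale {G : Type*} (R : FreeFrame G → FreeFrame G → Prop) :
    Sublocale (FreeFrame G) where
  carrier := {z | ∀ x y, R x y → x ⇨ z = y ⇨ z}
  sInf_mem' A hA x y hxy := by
    have e : ∀ w : FreeFrame G, w ⇨ sInf A = ⨅ z ∈ A, w ⇨ z := fun w => by
      rw [sInf_eq_iInf, himp_iInf_eq]
      exact iInf_congr fun _ => himp_iInf_eq
    rw [e, e]
    exact iInf_congr fun z => iInf_congr fun hz => hA hz x y hxy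
  himp_mem' a b hb x y hxy := by
    rw [himp_left_comm x, himp_left_comm y, hb x y hxy]

/-- The frame presented by the generators `G` and the relations `x = y`, for `R x y`. -/
def PresentedFrame {G : Type*} (R : FreeFrame G → FreeFrame G → Prop) : Type _ :=
  presentedSublocale R

namespace PresentedFrame

variable {G L : Type*} [Order.Frame L] {R : FreeFrame G → FreeFrame G → Prop}

instance : Order.Frame (PresentedFrame R) :=
  inferInstanceAs (Order.Frame (presentedSublocale R))

/-- The largest representative in the free frame. -/
def rep (z : PresentedFrame R) : FreeFrame G := Subtype.val (p := (· ∈ presentedSublocale R)) z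

/-- The quotient map from the free frame. -/
def mk (R : FreeFrame G → FreeFrame G → Prop) : FrameHom (FreeFrame G) (PresentedFrame R) :=
  (presentedSublocale R).restrict

theorem le_rep_mk (x : FreeFrame G) : x ≤ (mk R x).rep :=
  (presentedSublocale R).giRestrict.gc.le_u_l x

theorem mk_rep (z : PresentedFrame R) : mk R z.rep = z :=
  (presentedSublocale R).giRestrict.l_u_eq z

theorem mk_le_iff {x : FreeFrame G} {z : PresentedFrame R} : mk R x ≤ z ↔ x ≤ z.rep :=
  (presentedSublocale R).giRestrict.gc x z

theorem himp_rep {x y : FreeFrame G} (h : R x y) (z : PresentedFrame R) :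
    x ⇨ z.rep = y ⇨ z.rep := Subtype.prop (p := (· ∈ presentedSublocale R)) z x y h

theorem mk_eq {x y : FreeFrame G} (h : R x y) : mk R x = mk R y := by
  have aux : ∀ z : PresentedFrame R, x ≤ z.rep ↔ y ≤ z.rep := fun z => by
    rw [← himp_eq_top_iff, ← himp_eq_top_iff, himp_rep h z]
  refine eq_of_forall_ge_iff fun z => ?_
  rw [mk_le_iff, mk_le_iff, aux]

theorem lift_rep_mk (φ : G → L)
    (hφ : ∀ x y, R x y → FreeFrame.lift φ x = FreeFrame.lift φ y) (x : FreeFrame G) :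
    FreeFrame.lift φ (mk R x).rep = FreeFrame.lift φ x := by
  refine le_antisymm ?_ (OrderHomClass.mono (FreeFrame.lift φ) (le_rep_mk x))
  let w : FreeFrame G := sSup {u | FreeFrame.lift φ u ≤ FreeFrame.lift φ x}
  have hw : ∀ u, u ≤ w ↔ FreeFrame.lift φ u ≤ FreeFrame.lift φ x := by
    intro u
    constructor
    · intro h
      refine (OrderHomClass.mono (FreeFrame.lift φ) h).trans ?_
      change FreeFrame.lift φ (sSup _) ≤ _
      rw [map_sSup]
      refine sSup_le ?_
      rintro _ ⟨v, hv, rfl⟩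
      exact hv
    · intro h
      exact le_sSup h
  have hmem : w ∈ presentedSublocale R := by
    intro a b hab
    refine eq_of_forall_le_iff fun u => ?_
    rw [le_himp_iff, le_himp_iff, hw, hw, map_inf, map_inf, hφ a b hab]
  have h1 : mk R x ≤ (⟨w, hmem⟩ : PresentedFrame R) := mk_le_iff.2 ((hw x).2 le_rfl)
  exact (hw _).1 h1

/-- The universal property of the presented frame. -/
def lift (φ : G → L) (hφ : ∀ x y, R x y → FreeFrame.lift φ x = FreeFrame.lift φ y) :
    FrameHom (PresentedFrame R) L where
  toFun z := FreeFrame.lift φ z.rep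
  map_inf' a b := by
    rw [← map_inf]; rfl
  map_top' := by
    rw [← map_top (FreeFrame.lift φ), ← lift_rep_mk φ hφ ⊤, map_top]
  map_sSup' A := by
    have h : sSup A = mk R (sSup (rep '' A)) := by
      have e : mk R '' (rep '' A) = A := by
        rw [Set.image_image]
        simp only [mk_rep, Set.image_id']
      rw [map_sSup, e]
    rw [h, lift_rep_mk φ hφ, map_sSup, Set.image_image]

theorem lift_mk_of (φ : G → L)
    (hφ : ∀ x y, R x y → FreeFrame.lift φ x = FreeFrame.lift φ y) (g : G) :
    lift φ hφ (mk R (FreeFrame.of g)) = φ g :=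
  (lift_rep_mk φ hφ _).trans (FreeFrame.lift_of φ g)

theorem hom_ext {f g : FrameHom (PresentedFrame R) L}
    (h : ∀ x : G, f (mk R (FreeFrame.of x)) = g (mk R (FreeFrame.of x))) : f = g := by
  have e : f.comp (mk R) = g.comp (mk R) := FreeFrame.hom_ext h
  refine FrameHom.ext fun z => ?_
  rw [← mk_rep z]
  exact DFunLike.congr_fun e z.rep

end PresentedFrame

/-! ### The frame of reals -/

/-- The generators `(p,—)` and `(—,q)` of the frame of reals. -/
inductive RealGen : Type
  | above (p : ℚ) : RealGen
  | below (q : ℚ) : RealGen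

/-- The defining relations of the frame of reals, for the constructors of `RealGen`. -/
inductive RealRel : FreeFrame RealGen → FreeFrame RealGen → Prop
  | r1 (p q : ℚ) (h : q ≤ p) :
      RealRel (FreeFrame.of (.above p) ⊓ FreeFrame.of (.below q)) ⊥
  | r2 (p q : ℚ) (h : p < q) :
      RealRel (FreeFrame.of (.above p) ⊔ FreeFrame.of (.below q)) ⊤
  | r3 (p : ℚ) :
      RealRel (FreeFrame.of (.above p)) (⨆ q : ℚ, ⨆ _ : p < q, FreeFrame.of (.above q))
  | r4 (p : ℚ) :
      RealRel (FreeFrame.of (.below p)) (⨆ q : ℚ, ⨆ _ : q < p, FreeFrame.of (.below q))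
  | r5 : RealRel (⨆ p : ℚ, FreeFrame.of (.above p)) ⊤
  | r6 : RealRel (⨆ p : ℚ, FreeFrame.of (.below p)) ⊤

/-- The frame of reals `𝔏(ℝ)`. -/
abbrev FrameOfReals : Type := PresentedFrame RealRel

/-- The element `(p,—)` of the frame of reals. -/
def FrameOfReals.above (p : ℚ) : FrameOfReals := PresentedFrame.mk RealRel (FreeFrame.of (.above p))

/-- The element `(—,q)` of the frame of reals. -/
def FrameOfReals.below (q : ℚ) : FrameOfReals := PresentedFrame.mk RealRel (FreeFrame.of (.below q))

/-! ### Continuous real functions on a frame -/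

/-- `C(L)`: the continuous real functions on a frame `L`, that is, the frame homomorphisms
`𝔏(ℝ) → L`. The definition is a structure in order not to inherit the pointwise order of frame
homomorphisms, which is not the order of `C(L)`. -/
@[ext]
structure ContReal (L : Type*) [Order.Frame L] where
  /-- The underlying frame homomorphism. -/
  hom : FrameHom FrameOfReals L

namespace ContReal

variable {L : Type*} [Order.Frame L]

/-- `f(p,—)` -/
def gt (f : ContReal L) (p : ℚ) : L := f.hom (FrameOfReals.above p)

/-- `f(—,q)` -/
def lt (f : ContReal L) (q : ℚ) : L := f.hom (FrameOfReals.below q)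

theorem r1 (f : ContReal L) {p q : ℚ} (h : q ≤ p) : f.gt p ⊓ f.lt q = ⊥ := by
  have := congrArg f.hom (PresentedFrame.mk_eq (RealRel.r1 p q h))
  simpa only [map_inf, map_bot] using! this

theorem r2 (f : ContReal L) {p q : ℚ} (h : p < q) : f.gt p ⊔ f.lt q = ⊤ := by
  have := congrArg f.hom (PresentedFrame.mk_eq (RealRel.r2 p q h))
  simpa only [map_sup, map_top] using! this

theorem r3 (f : ContReal L) (p : ℚ) : f.gt p = ⨆ q : ℚ, ⨆ _ : p < q, f.gt q := by
  have := congrArg f.hom (PresentedFrame.mk_eq (RealRel.r3 p))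
  simpa only [map_iSup] using! this

theorem r4 (f : ContReal L) (p : ℚ) : f.lt p = ⨆ q : ℚ, ⨆ _ : q < p, f.lt q := by
  have := congrArg f.hom (PresentedFrame.mk_eq (RealRel.r4 p))
  simpa only [map_iSup] using! this

theorem r5 (f : ContReal L) : ⨆ p : ℚ, f.gt p = ⊤ := by
  have := congrArg f.hom (PresentedFrame.mk_eq RealRel.r5)
  simpa only [map_iSup, map_top] using! this

theorem r6 (f : ContReal L) : ⨆ p : ℚ, f.lt p = ⊤ := by
  have := congrArg f.hom (PresentedFrame.mk_eq RealRel.r6)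
  simpa only [map_iSup, map_top] using! this

theorem rel_of_gen {φ : RealGen → L}
    (h1 : ∀ p q, q ≤ p → φ (.above p) ⊓ φ (.below q) = ⊥)
    (h2 : ∀ p q, p < q → φ (.above p) ⊔ φ (.below q) = ⊤)
    (h3 : ∀ p, φ (.above p) = ⨆ q : ℚ, ⨆ _ : p < q, φ (.above q))
    (h4 : ∀ p, φ (.below p) = ⨆ q : ℚ, ⨆ _ : q < p, φ (.below q))
    (h5 : ⨆ p, φ (.above p) = ⊤) (h6 : ⨆ p, φ (.below p) = ⊤)
    (x y : FreeFrame RealGen) (h : RealRel x y) :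
    FreeFrame.lift φ x = FreeFrame.lift φ y := by
  cases h with
  | r1 p q h => simpa only [map_inf, map_bot, FreeFrame.lift_of] using h1 p q h
  | r2 p q h => simpa only [map_sup, map_top, FreeFrame.lift_of] using h2 p q h
  | r3 p => simpa only [map_iSup, FreeFrame.lift_of] using h3 p
  | r4 p => simpa only [map_iSup, FreeFrame.lift_of] using h4 p
  | r5 => simpa only [map_iSup, map_top, FreeFrame.lift_of] using h5
  | r6 => simpa only [map_iSup, map_top, FreeFrame.lift_of] using h6

/-- The continuous real function determined by its values on the generators. -/
def ofGen (u l : ℚ → L)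
    (h1 : ∀ p q, q ≤ p → u p ⊓ l q = ⊥) (h2 : ∀ p q, p < q → u p ⊔ l q = ⊤)
    (h3 : ∀ p, u p = ⨆ q : ℚ, ⨆ _ : p < q, u q) (h4 : ∀ p, l p = ⨆ q : ℚ, ⨆ _ : q < p, l q)
    (h5 : ⨆ p, u p = ⊤) (h6 : ⨆ p, l p = ⊤) : ContReal L where
  hom := PresentedFrame.lift (fun g => RealGen.rec u l g) (rel_of_gen h1 h2 h3 h4 h5 h6)

@[simp]
theorem gt_ofGen (u l : ℚ → L) (h1 h2 h3 h4 h5 h6) (p : ℚ) :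
    (ofGen u l h1 h2 h3 h4 h5 h6).gt p = u p :=
  PresentedFrame.lift_mk_of _ (rel_of_gen h1 h2 h3 h4 h5 h6) _

@[simp]
theorem lt_ofGen (u l : ℚ → L) (h1 h2 h3 h4 h5 h6) (q : ℚ) :
    (ofGen u l h1 h2 h3 h4 h5 h6).lt q = l q :=
  PresentedFrame.lift_mk_of _ (rel_of_gen h1 h2 h3 h4 h5 h6) _

theorem ext_gen {f g : ContReal L} (hu : ∀ p, f.gt p = g.gt p) (hl : ∀ q, f.lt q = g.lt q) :
    f = g := by
  refine ContReal.ext (PresentedFrame.hom_ext fun x => ?_)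
  cases x with
  | above p => exact hu p
  | below q => exact hl q

theorem gt_anti (f : ContReal L) {p q : ℚ} (h : p ≤ q) : f.gt q ≤ f.gt p := by
  rcases h.eq_or_lt with rfl | h
  · exact le_rfl
  · rw [f.r3 p]; exact le_iSup₂_of_le q h le_rfl

theorem lt_mono (f : ContReal L) {p q : ℚ} (h : p ≤ q) : f.lt p ≤ f.lt q := by
  rcases h.eq_or_lt with rfl | h
  · exact le_rfl
  · rw [f.r4 q]; exact le_iSup₂_of_le p h le_rfl

theorem gt_le_of_forall (f : ContReal L) {p : ℚ} {a : L} (h : ∀ q, p < q → f.gt q ≤ a) :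
    f.gt p ≤ a := by
  rw [f.r3 p]; exact iSup₂_le h

theorem lt_le_of_forall (f : ContReal L) {q : ℚ} {a : L} (h : ∀ p, p < q → f.lt p ≤ a) :
    f.lt q ≤ a := by
  rw [f.r4 q]; exact iSup₂_le h

/-! ### The order of `C(L)` -/

instance : LE (ContReal L) := ⟨fun f g => ∀ p, f.gt p ≤ g.gt p⟩

theorem le_def {f g : ContReal L} : f ≤ g ↔ ∀ p, f.gt p ≤ g.gt p := Iff.rfl

theorem le_iff_inf {f g : ContReal L} : f ≤ g ↔ ∀ p, f.gt p ⊓ g.lt p = ⊥ := by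
  constructor
  · intro h p
    exact le_bot_iff.1 ((inf_le_inf_right _ (h p)).trans_eq (g.r1 le_rfl))
  · intro h p
    refine f.gt_le_of_forall fun q hq => ?_
    calc f.gt q = f.gt q ⊓ (g.gt p ⊔ g.lt q) := by rw [g.r2 hq, inf_top_eq]
      _ = f.gt q ⊓ g.gt p := by rw [inf_sup_left, h q, sup_bot_eq]
      _ ≤ g.gt p := inf_le_right

theorem le_iff_lt {f g : ContReal L} : f ≤ g ↔ ∀ q, g.lt q ≤ f.lt q := by
  constructor
  · intro h p
    refine g.lt_le_of_forall fun q hq => ?_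
    calc g.lt q = g.lt q ⊓ (f.gt q ⊔ f.lt p) := by rw [f.r2 hq, inf_top_eq]
      _ = g.lt q ⊓ f.lt p := by
        rw [inf_sup_left, inf_comm _ (f.gt q), le_iff_inf.1 h q, bot_sup_eq]
      _ ≤ f.lt p := inf_le_right
  · intro h
    refine le_iff_inf.2 fun p => le_bot_iff.1 ?_
    exact (inf_le_inf_left _ (h p)).trans_eq (f.r1 le_rfl)

instance : PartialOrder (ContReal L) where
  le_refl _ _ := le_rfl
  le_trans _ _ _ h h' p := (h p).trans (h' p)
  le_antisymm f g h h' := ext_gen (fun p => le_antisymm (h p) (h' p))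
    fun q => le_antisymm (le_iff_lt.1 h' q) (le_iff_lt.1 h q)

/-! ### Local approximation -/

/-- On the part `a` of the frame, the function given by `u = f(·,—)` and `l = f(—,·)` takes values
in `[x - ε, x + ε]`. -/
def Near (u l : ℚ → L) (a : L) (x ε : ℝ) : Prop :=
  (∀ p : ℚ, (p : ℝ) < x - ε → a ≤ u p) ∧ ∀ q : ℚ, x + ε < (q : ℝ) → a ≤ l q

theorem Near.mono {u l : ℚ → L} {a b : L} {x ε : ℝ} (h : Near u l a x ε) (hb : b ≤ a) :
    Near u l b x ε :=
  ⟨fun p hp => hb.trans (h.1 p hp), fun q hq => hb.trans (h.2 q hq)⟩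

/-- The function given by `u` and `l` is, locally, arbitrarily well approximated by numbers. -/
def Local (u l : ℚ → L) : Prop :=
  ∀ (ε : ℝ), 0 < ε → ∀ a v : L, (∀ b ≤ a, ∀ x : ℝ, Near u l b x ε → b ≤ v) → a ≤ v

theorem isLocal (f : ContReal L) : Local f.gt f.lt := by
  intro ε hε a v h
  obtain ⟨δ, hδ0, hδ⟩ := exists_rat_btwn hε
  have hδ0' : (0 : ℚ) < δ := by exact_mod_cast hδ0
  have key : ∀ (n : ℕ) (s t : ℚ), t - s ≤ n * (δ / 2) → a ⊓ (f.gt s ⊓ f.lt t) ≤ v := by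
    intro n
    induction n with
    | zero =>
      intro s t hst
      rw [f.r1 (by push_cast at hst; linarith), inf_bot_eq]
      exact bot_le
    | succ n ih =>
      intro s t hst
      calc a ⊓ (f.gt s ⊓ f.lt t)
          = (a ⊓ (f.gt s ⊓ f.lt t)) ⊓ (f.gt (s + δ / 2) ⊔ f.lt (s + δ)) := by
            rw [f.r2 (by linarith), inf_top_eq]
        _ ≤ v := by
            rw [inf_sup_left]
            refine sup_le ?_ ?_
            · refine le_trans ?_ (ih (s + δ / 2) t (by push_cast at hst; linarith))
              exact le_inf (inf_le_left.trans inf_le_left)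
                (le_inf inf_le_right (inf_le_left.trans (inf_le_right.trans inf_le_right)))
            · refine h _ (inf_le_left.trans inf_le_left) s ⟨fun p hp => ?_, fun q hq => ?_⟩
              · refine inf_le_left.trans (inf_le_right.trans (inf_le_left.trans (f.gt_anti ?_)))
                have : (p : ℝ) < s := by linarith
                exact_mod_cast this.le
              · refine inf_le_right.trans (f.lt_mono ?_)
                have : ((s + δ : ℚ) : ℝ) < q := by push_cast; linarith
                exact_mod_cast this.le
  calc a = a ⊓ ((⨆ s, f.gt s) ⊓ ⨆ t, f.lt t) := by rw [f.r5, f.r6, inf_top_eq, inf_top_eq]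
    _ ≤ v := by
      rw [iSup_inf_iSup, inf_iSup_eq]
      refine iSup_le fun i => ?_
      obtain ⟨n, hn⟩ := exists_nat_ge ((i.2 - i.1) / (δ / 2))
      exact key n _ _ ((div_le_iff₀ (by linarith)).1 hn)

/-- A continuous real function from values on the generators for which the relations with value `⊤` are
replaced by local approximability. -/
def ofLocal (u l : ℚ → L) (h1 : ∀ p q, q ≤ p → u p ⊓ l q = ⊥)
    (h3 : ∀ p, u p = ⨆ q : ℚ, ⨆ _ : p < q, u q) (h4 : ∀ p, l p = ⨆ q : ℚ, ⨆ _ : q < p, l q)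
    (h : Local u l) : ContReal L :=
  ofGen u l h1
    (fun p q hpq => by
      refine top_le_iff.1 (h (((q : ℝ) - p) / 4) ?_ _ _ fun b _ x hb => ?_)
      · have : (p : ℝ) < q := by exact_mod_cast hpq
        linarith
      · have : (p : ℝ) < q := by exact_mod_cast hpq
        rcases lt_or_ge (p : ℝ) (x - ((q : ℝ) - p) / 4) with h' | h'
        · exact (hb.1 p h').trans le_sup_left
        · exact (hb.2 q (by linarith)).trans le_sup_right)
    h3 h4
    (top_le_iff.1 (h 1 one_pos _ _ fun b _ x hb => by
      obtain ⟨p, hp⟩ := exists_rat_lt (x - 1)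
      exact (hb.1 p hp).trans (le_iSup u p)))
    (top_le_iff.1 (h 1 one_pos _ _ fun b _ x hb => by
      obtain ⟨p, hp⟩ := exists_rat_gt (x + 1)
      exact (hb.2 p hp).trans (le_iSup l p)))

@[simp]
theorem gt_ofLocal (u l : ℚ → L) (h1 h3 h4 h) (p : ℚ) : (ofLocal u l h1 h3 h4 h).gt p = u p :=
  gt_ofGen _ _ _ _ _ _ _ _ _

@[simp]
theorem lt_ofLocal (u l : ℚ → L) (h1 h3 h4 h) (q : ℚ) : (ofLocal u l h1 h3 h4 h).lt q = l q :=
  lt_ofGen _ _ _ _ _ _ _ _ _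

theorem le_of_near {f g : ContReal L}
    (h : ∀ ε : ℝ, 0 < ε → ∀ a v : L, (∀ b ≤ a, ∀ x y : ℝ, x ≤ y → Near f.gt f.lt b x ε →
      Near g.gt g.lt b y ε → b ≤ v) → a ≤ v) : f ≤ g := by
  refine fun p => f.gt_le_of_forall fun q hq => ?_
  have hpq : (p : ℝ) < q := by exact_mod_cast hq
  refine h (((q : ℝ) - p) / 4) (by linarith) _ _ fun b hb x y hxy hf hg => ?_
  rcases lt_or_ge (p : ℝ) (y - ((q : ℝ) - p) / 4) with h' | h'
  · exact hg.1 p h'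
  · have := le_inf hb (hf.2 q (by linarith))
    rw [f.r1 le_rfl] at this
    exact this.trans bot_le

theorem eq_of_near {f g : ContReal L}
    (h : ∀ ε : ℝ, 0 < ε → ∀ a v : L, (∀ b ≤ a, ∀ x : ℝ, Near f.gt f.lt b x ε →
      Near g.gt g.lt b x ε → b ≤ v) → a ≤ v) : f = g :=
  le_antisymm
    (le_of_near fun ε hε a v H => h ε hε a v fun b hb x hf hg => H b hb x x le_rfl hf hg)
    (le_of_near fun ε hε a v H => h ε hε a v fun b hb x hf hg => H b hb x x le_rfl hg hf)

/-! ### Lattice operations and algebraic operations -/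

/-- `(-f)(p,—) = f(—,-p)` and `(-f)(—,q) = f(-q,—)`. -/
instance : Neg (ContReal L) where
  neg f := ofGen (fun p => f.lt (-p)) (fun q => f.gt (-q))
    (fun p q h => by rw [inf_comm]; exact f.r1 (neg_le_neg h))
    (fun p q h => by rw [sup_comm]; exact f.r2 (neg_lt_neg h))
    (fun p => le_antisymm
      (f.lt_le_of_forall fun q hq => le_iSup₂_of_le (-q) (by linarith) (by rw [neg_neg]))
      (iSup₂_le fun q hq => f.lt_mono (by linarith)))
    (fun p => le_antisymm
      (f.gt_le_of_forall fun q hq => le_iSup₂_of_le (-q) (by linarith) (by rw [neg_neg]))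
      (iSup₂_le fun q hq => f.gt_anti (by linarith)))
    ((Equiv.neg ℚ).iSup_comp (g := f.lt) |>.trans f.r6)
    ((Equiv.neg ℚ).iSup_comp (g := f.gt) |>.trans f.r5)

@[simp] theorem gt_neg (f : ContReal L) (p : ℚ) : (-f).gt p = f.lt (-p) :=
  gt_ofGen _ _ _ _ _ _ _ _ _

@[simp] theorem lt_neg (f : ContReal L) (q : ℚ) : (-f).lt q = f.gt (-q) :=
  lt_ofGen _ _ _ _ _ _ _ _ _

theorem neg_neg' (f : ContReal L) : - -f = f :=
  ext_gen (fun p => by simp) (fun p => by simp)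

theorem neg_le_neg' {f g : ContReal L} (h : f ≤ g) : -g ≤ -f := by
  intro p
  rw [gt_neg, gt_neg]
  exact le_iff_lt.1 h _

/-- `(f ∨ g)(p,—) = f(p,—) ∨ g(p,—)` and `(f ∨ g)(—,q) = f(—,q) ∧ g(—,q)`. -/
instance : Max (ContReal L) where
  max f g := ofGen (fun p => f.gt p ⊔ g.gt p) (fun q => f.lt q ⊓ g.lt q)
    (fun p q h => by
      refine le_bot_iff.1 ?_
      rw [inf_sup_right]
      exact sup_le ((inf_le_inf_left _ inf_le_left).trans_eq (f.r1 h))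
        ((inf_le_inf_left _ inf_le_right).trans_eq (g.r1 h)))
    (fun p q h => by
      refine top_le_iff.1 ?_
      rw [sup_inf_left]
      exact le_inf ((f.r2 h).symm.le.trans (sup_le_sup_right le_sup_left _))
        ((g.r2 h).symm.le.trans (sup_le_sup_right le_sup_right _)))
    (fun p => le_antisymm
      (sup_le
        (f.gt_le_of_forall fun q hq => le_iSup₂_of_le q hq le_sup_left)
        (g.gt_le_of_forall fun q hq => le_iSup₂_of_le q hq le_sup_right))
      (iSup₂_le fun q hq => sup_le_sup (f.gt_anti hq.le) (g.gt_anti hq.le)))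
    (fun p => le_antisymm
      (by
        rw [f.r4 p, g.r4 p]
        simp only [iSup_inf_eq, inf_iSup_eq]
        refine iSup₂_le fun r hr => iSup₂_le fun s hs => ?_
        exact le_iSup₂_of_le (max s r) (max_lt hs hr)
          (inf_le_inf (f.lt_mono (by simp)) (g.lt_mono (by simp))))
      (iSup₂_le fun q hq => inf_le_inf (f.lt_mono hq.le) (g.lt_mono hq.le)))
    (by rw [iSup_sup_eq, f.r5, top_sup_eq])
    (by
      refine top_le_iff.1 ?_
      rw [← inf_top_eq (⊤ : L)]
      nth_rewrite 1 [← f.r6]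
      rw [← g.r6, iSup_inf_iSup]
      refine iSup_le fun i => le_iSup_of_le (max i.1 i.2) ?_
      exact inf_le_inf (f.lt_mono (by simp)) (g.lt_mono (by simp)))

@[simp] theorem gt_sup (f g : ContReal L) (p : ℚ) : (f ⊔ g).gt p = f.gt p ⊔ g.gt p :=
  gt_ofGen _ _ _ _ _ _ _ _ _

@[simp] theorem lt_sup (f g : ContReal L) (q : ℚ) : (f ⊔ g).lt q = f.lt q ⊓ g.lt q :=
  lt_ofGen _ _ _ _ _ _ _ _ _

/-- `f ∧ g = -(-f ∨ -g)`, so that `(f ∧ g)(p,—) = f(p,—) ∧ g(p,—)` and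
`(f ∧ g)(—,q) = f(—,q) ∨ g(—,q)`. -/
instance : Min (ContReal L) where
  min f g := -(-f ⊔ -g)

@[simp] theorem gt_inf (f g : ContReal L) (p : ℚ) : (f ⊓ g).gt p = f.gt p ⊓ g.gt p := by
  change (-(-f ⊔ -g)).gt p = _
  simp

@[simp] theorem lt_inf (f g : ContReal L) (q : ℚ) : (f ⊓ g).lt q = f.lt q ⊔ g.lt q := by
  change (-(-f ⊔ -g)).lt q = _
  simp

instance : Lattice (ContReal L) where
  sup f g := f ⊔ g
  inf f g := f ⊓ g
  le_sup_left f g p := by rw [gt_sup]; exact le_sup_left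
  le_sup_right f g p := by rw [gt_sup]; exact le_sup_right
  sup_le f g k h h' p := by rw [gt_sup]; exact sup_le (h p) (h' p)
  inf_le_left f g p := by rw [gt_inf]; exact inf_le_left
  inf_le_right f g p := by rw [gt_inf]; exact inf_le_right
  le_inf f g k h h' p := by rw [gt_inf]; exact le_inf (h p) (h' p)

/-- The constant function `0`: `0(p,—)` is `1` for `p < 0` and `0` otherwise, and
`0(—,q)` is `1` for `q > 0` and `0` otherwise. -/
instance : Zero (ContReal L) where
  zero := ofLocal (fun p => ⨆ _ : p < 0, ⊤) (fun q => ⨆ _ : 0 < q, ⊤)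
    (fun p q h => by
      refine le_bot_iff.1 ?_
      rw [iSup_inf_eq]
      refine iSup_le fun hp => ?_
      rw [inf_iSup_eq]
      exact iSup_le fun hq => absurd (hq.trans_le h) (not_lt.2 hp.le))
    (fun p => le_antisymm
      (iSup_le fun hp => le_iSup₂_of_le (p / 2) (by linarith) (le_iSup_of_le (by linarith) le_rfl))
      (iSup₂_le fun q hq => iSup_le fun hq0 => le_iSup_of_le (hq.trans hq0) le_rfl))
    (fun p => le_antisymm
      (iSup_le fun hp => le_iSup₂_of_le (p / 2) (by linarith) (le_iSup_of_le (by linarith) le_rfl))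
      (iSup₂_le fun q hq => iSup_le fun hq0 => le_iSup_of_le (hq0.trans hq) le_rfl))
    (fun ε hε a v h => h a le_rfl 0
      ⟨fun p hp => le_iSup_of_le (by
          have : (p : ℝ) < 0 := by linarith
          exact_mod_cast this) le_top,
        fun p hp => le_iSup_of_le (by
          have : (0 : ℝ) < p := by linarith
          exact_mod_cast this) le_top⟩)

@[simp] theorem gt_zero (p : ℚ) : (0 : ContReal L).gt p = ⨆ _ : p < 0, ⊤ :=
  gt_ofLocal _ _ _ _ _ _ _

@[simp] theorem lt_zero (q : ℚ) : (0 : ContReal L).lt q = ⨆ _ : 0 < q, ⊤ :=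
  lt_ofLocal _ _ _ _ _ _ _

theorem near_zero (a : L) {ε : ℝ} (hε : 0 ≤ ε) :
    Near (0 : ContReal L).gt (0 : ContReal L).lt a 0 ε := by
  refine ⟨fun p hp => ?_, fun p hp => ?_⟩
  · rw [gt_zero]
    exact le_iSup_of_le (by
      have : (p : ℝ) < 0 := by linarith
      exact_mod_cast this) le_top
  · rw [lt_zero]
    exact le_iSup_of_le (by
      have : (0 : ℝ) < p := by linarith
      exact_mod_cast this) le_top

theorem near_neg {f : ContReal L} {a : L} {x ε : ℝ} (h : Near f.gt f.lt a x ε) :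
    Near (-f).gt (-f).lt a (-x) ε := by
  refine ⟨fun p hp => ?_, fun p hp => ?_⟩
  · rw [gt_neg]; exact h.2 _ (by push_cast; linarith)
  · rw [lt_neg]; exact h.1 _ (by push_cast; linarith)

theorem near_add_aux {u l u' l' : ℚ → L} {a : L} {x y ε δ : ℝ}
    (h : Near u l a x ε) (h' : Near u' l' a y δ) :
    Near (fun p => ⨆ r : ℚ, u r ⊓ u' (p - r)) (fun q => ⨆ s : ℚ, l s ⊓ l' (q - s)) a
      (x + y) (ε + δ) := by
  refine ⟨fun p hp => ?_, fun q hq => ?_⟩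
  · obtain ⟨r, hr, hr'⟩ := exists_rat_btwn (show (p : ℝ) - (y - δ) < x - ε by linarith)
    exact le_iSup_of_le r (le_inf (h.1 r hr') (h'.1 _ (by push_cast; linarith)))
  · obtain ⟨r, hr, hr'⟩ := exists_rat_btwn (show x + ε < (q : ℝ) - (y + δ) by linarith)
    exact le_iSup_of_le r (le_inf (h.2 r hr) (h'.2 _ (by push_cast; linarith)))

/-- `(f + g)(p,—) = ⋁ᵣ f(r,—) ∧ g(p-r,—)` and `(f + g)(—,q) = ⋁ₛ f(—,s) ∧ g(—,q-s)`. -/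
instance : Add (ContReal L) where
  add f g := ofLocal (fun p => ⨆ r : ℚ, f.gt r ⊓ g.gt (p - r))
    (fun q => ⨆ s : ℚ, f.lt s ⊓ g.lt (q - s))
    (fun p q h => by
      refine le_bot_iff.1 ?_
      rw [iSup_inf_iSup]
      refine iSup_le fun i => ?_
      rcases le_total i.2 i.1 with h' | h'
      · exact (inf_le_inf inf_le_left inf_le_left).trans_eq (f.r1 h')
      · exact (inf_le_inf inf_le_right inf_le_right).trans_eq (g.r1 (by linarith)))
    (fun p => le_antisymm
      (iSup_le fun r => by
        rw [g.r3 (p - r)]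
        simp only [inf_iSup_eq]
        refine iSup₂_le fun q hq => le_iSup₂_of_le (q + r) (by linarith) (le_iSup_of_le r ?_)
        rw [add_sub_cancel_right])
      (iSup₂_le fun q hq => iSup_mono fun r => inf_le_inf_left _ (g.gt_anti (by linarith))))
    (fun p => le_antisymm
      (iSup_le fun r => by
        rw [g.r4 (p - r)]
        simp only [inf_iSup_eq]
        refine iSup₂_le fun q hq => le_iSup₂_of_le (q + r) (by linarith) (le_iSup_of_le r ?_)
        rw [add_sub_cancel_right])
      (iSup₂_le fun q hq => iSup_mono fun r => inf_le_inf_left _ (g.lt_mono (by linarith))))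
    (fun ε hε a v h => by
      refine f.isLocal (ε / 2) (half_pos hε) a v fun b hb x hx => ?_
      refine g.isLocal (ε / 2) (half_pos hε) b v fun c hc y hy => ?_
      refine h c (hc.trans hb) (x + y) ?_
      have := near_add_aux (hx.mono hc) hy
      rwa [add_halves] at this)

theorem gt_add (f g : ContReal L) (p : ℚ) : (f + g).gt p = ⨆ r : ℚ, f.gt r ⊓ g.gt (p - r) :=
  gt_ofLocal _ _ _ _ _ _ _

theorem lt_add (f g : ContReal L) (q : ℚ) : (f + g).lt q = ⨆ s : ℚ, f.lt s ⊓ g.lt (q - s) :=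
  lt_ofLocal _ _ _ _ _ _ _

theorem near_add {f g : ContReal L} {a : L} {x y ε δ : ℝ}
    (h : Near f.gt f.lt a x ε) (h' : Near g.gt g.lt a y δ) :
    Near (f + g).gt (f + g).lt a (x + y) (ε + δ) := by
  have e1 := funext (gt_add f g)
  have e2 := funext (lt_add f g)
  rw [e1, e2]
  exact near_add_aux h h'

theorem near_smul_aux {u l : ℚ → L} {a : L} {x ε : ℝ} (c : ℝ) (h : Near u l a x ε) :
    Near (fun p => ⨆ i : ℚ × ℚ, ⨆ _ : (p : ℝ) < c * i.1 ∧ (p : ℝ) < c * i.2, u i.1 ⊓ l i.2)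
      (fun q => ⨆ i : ℚ × ℚ, ⨆ _ : c * i.1 < (q : ℝ) ∧ c * i.2 < (q : ℝ), u i.1 ⊓ l i.2)
      a (c * x) (|c| * ε) := by
  have main : ∀ (c p : ℝ), p < c * x - |c| * ε →
      ∃ r s : ℚ, (r : ℝ) < x - ε ∧ x + ε < (s : ℝ) ∧ p < c * r ∧ p < c * s := by
    intro c p hp
    rcases lt_trichotomy c 0 with hc | rfl | hc
    · rw [abs_of_neg hc] at hp
      have h1 : x + ε < p / c := by rw [lt_div_iff_of_neg hc]; linarith
      obtain ⟨s, hs, hs'⟩ := exists_rat_btwn h1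
      obtain ⟨r, hr⟩ := exists_rat_lt (min (x - ε) (p / c))
      refine ⟨r, s, hr.trans_le (min_le_left _ _), hs, ?_, ?_⟩
      · have := (lt_div_iff_of_neg hc).1 (hr.trans_le (min_le_right _ _)); linarith
      · have := (lt_div_iff_of_neg hc).1 hs'; linarith
    · obtain ⟨r, hr⟩ := exists_rat_lt (x - ε)
      obtain ⟨s, hs⟩ := exists_rat_gt (x + ε)
      simp only [zero_mul, abs_zero, sub_zero] at hp ⊢
      exact ⟨r, s, hr, hs, hp, hp⟩
    · rw [abs_of_pos hc] at hp
      have h1 : p / c < x - ε := by rw [div_lt_iff₀ hc]; linarith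
      obtain ⟨r, hr, hr'⟩ := exists_rat_btwn h1
      obtain ⟨s, hs⟩ := exists_rat_gt (max (x + ε) (p / c))
      refine ⟨r, s, hr', (le_max_left _ _).trans_lt hs, ?_, ?_⟩
      · have := (div_lt_iff₀ hc).1 hr; linarith
      · have := (div_lt_iff₀ hc).1 ((le_max_right _ _).trans_lt hs); linarith
  refine ⟨fun p hp => ?_, fun q hq => ?_⟩
  · obtain ⟨r, s, hr, hs, h1, h2⟩ := main c p hp
    exact le_iSup₂_of_le (r, s) ⟨h1, h2⟩ (le_inf (h.1 r hr) (h.2 s hs))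
  · obtain ⟨r, s, hr, hs, h1, h2⟩ := main (-c) (-q) (by rw [abs_neg]; linarith)
    exact le_iSup₂_of_le (r, s) ⟨by simp only; linarith, by simp only; linarith⟩
      (le_inf (h.1 r hr) (h.2 s hs))

theorem smul_between {c p : ℝ} {r s : ℚ} (h1 : p < c * r) (h2 : p < c * s) :
    ∃ p' : ℚ, p < p' ∧ (p' : ℝ) < c * r ∧ (p' : ℝ) < c * s := by
  obtain ⟨p', h, h'⟩ := exists_rat_btwn (lt_min h1 h2)
  exact ⟨p', h, h'.trans_le (min_le_left _ _), h'.trans_le (min_le_right _ _)⟩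

/-- Multiplication by a real number `c`, by the usual formula:
`(c f)(p,—) = ⋁ {f(r,s) | c t > p for all t in [r,s]}` and
`(c f)(—,q) = ⋁ {f(r,s) | c t < q for all t in [r,s]}`, where `f(r,s) = f(r,—) ∧ f(—,s)`. -/
noncomputable instance : SMul ℝ (ContReal L) where
  smul c f := ofLocal
    (fun p => ⨆ i : ℚ × ℚ, ⨆ _ : (p : ℝ) < c * i.1 ∧ (p : ℝ) < c * i.2, f.gt i.1 ⊓ f.lt i.2)
    (fun q => ⨆ i : ℚ × ℚ, ⨆ _ : c * i.1 < (q : ℝ) ∧ c * i.2 < (q : ℝ), f.gt i.1 ⊓ f.lt i.2)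
    (fun p q h => by
      have hqp : (q : ℝ) ≤ p := by exact_mod_cast h
      refine le_bot_iff.1 ?_
      simp only [iSup_inf_eq, inf_iSup_eq]
      refine iSup₂_le fun i hi => iSup₂_le fun j hj => ?_
      rcases le_or_gt j.2 i.1 with h1 | h1
      · exact (le_inf (inf_le_right.trans inf_le_left)
          (inf_le_left.trans inf_le_right)).trans_eq (f.r1 h1)
      rcases le_or_gt i.2 j.1 with h2 | h2
      · exact (inf_le_inf inf_le_left inf_le_right).trans_eq (f.r1 h2)
      exfalso
      have h1' : (i.1 : ℝ) < j.2 := by exact_mod_cast h1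
      have h2' : (j.1 : ℝ) < i.2 := by exact_mod_cast h2
      rcases le_total 0 c with hc | hc
      · nlinarith [hi.1, hj.2, mul_le_mul_of_nonneg_left h1'.le hc,
          mul_le_mul_of_nonneg_left h2'.le hc, hi.2, hj.1]
      · nlinarith [hi.1, hj.2, mul_le_mul_of_nonpos_left h1'.le hc,
          mul_le_mul_of_nonpos_left h2'.le hc, hi.2, hj.1])
    (fun p => le_antisymm
      (iSup₂_le fun i hi => by
        obtain ⟨p', h, h1, h2⟩ := smul_between hi.1 hi.2
        exact le_iSup₂_of_le p' (by exact_mod_cast h) (le_iSup₂_of_le i ⟨h1, h2⟩ le_rfl))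
      (iSup₂_le fun q hq => iSup₂_le fun i hi => by
        have hq' : (p : ℝ) < q := by exact_mod_cast hq
        exact le_iSup₂_of_le i ⟨hq'.trans hi.1, hq'.trans hi.2⟩ le_rfl))
    (fun p => le_antisymm
      (iSup₂_le fun i hi => by
        obtain ⟨p', h, h'⟩ := exists_rat_btwn (max_lt hi.1 hi.2)
        exact le_iSup₂_of_le p' (by exact_mod_cast h')
          (le_iSup₂_of_le i ⟨(le_max_left _ _).trans_lt h, (le_max_right _ _).trans_lt h⟩ le_rfl))
      (iSup₂_le fun q hq => iSup₂_le fun i hi => by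
        have hq' : (q : ℝ) < p := by exact_mod_cast hq
        exact le_iSup₂_of_le i ⟨hi.1.trans hq', hi.2.trans hq'⟩ le_rfl))
    (fun ε hε a v h => by
      have hc : 0 < |c| + 1 := by positivity
      refine f.isLocal (ε / (|c| + 1)) (by positivity) a v fun b hb x hx => ?_
      refine h b hb (c * x) ?_
      have := near_smul_aux c hx
      have hle : |c| * (ε / (|c| + 1)) ≤ ε := by
        rw [mul_div_assoc', div_le_iff₀ hc]; nlinarith
      exact ⟨fun p hp => this.1 p (by linarith), fun q hq => this.2 q (by linarith)⟩)

theorem gt_smul (c : ℝ) (f : ContReal L) (p : ℚ) : (c • f).gt p =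
    ⨆ i : ℚ × ℚ, ⨆ _ : (p : ℝ) < c * i.1 ∧ (p : ℝ) < c * i.2, f.gt i.1 ⊓ f.lt i.2 :=
  gt_ofLocal _ _ _ _ _ _ _

theorem lt_smul (c : ℝ) (f : ContReal L) (q : ℚ) : (c • f).lt q =
    ⨆ i : ℚ × ℚ, ⨆ _ : c * i.1 < (q : ℝ) ∧ c * i.2 < (q : ℝ), f.gt i.1 ⊓ f.lt i.2 :=
  lt_ofLocal _ _ _ _ _ _ _

theorem near_smul {f : ContReal L} {a : L} {x ε : ℝ} (c : ℝ) (h : Near f.gt f.lt a x ε) :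
    Near (c • f).gt (c • f).lt a (c * x) (|c| * ε) := by
  have e1 := funext (gt_smul c f)
  have e2 := funext (lt_smul c f)
  rw [e1, e2]
  exact near_smul_aux c h

theorem Near.weaken {u l : ℚ → L} {a : L} {x y ε δ : ℝ} (h : Near u l a x ε) (hxy : x = y)
    (hεδ : ε ≤ δ) : Near u l a y δ := by
  subst hxy
  exact ⟨fun p hp => h.1 p (by linarith), fun q hq => h.2 q (by linarith)⟩

/-! ### The Riesz space `C(L)` -/

instance : AddCommGroup (ContReal L) where
  add_assoc f g k := eq_of_near fun ε hε a v H => by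
    refine f.isLocal (ε / 3) (by linarith) a v fun a₁ h₁ x hx => ?_
    refine g.isLocal (ε / 3) (by linarith) a₁ v fun a₂ h₂ y hy => ?_
    refine k.isLocal (ε / 3) (by linarith) a₂ v fun a₃ h₃ z hz => ?_
    have hx' := hx.mono (h₃.trans h₂)
    have hy' := hy.mono h₃
    exact H a₃ (h₃.trans (h₂.trans h₁)) (x + y + z)
      ((near_add (near_add hx' hy') hz).weaken rfl (by linarith))
      ((near_add hx' (near_add hy' hz)).weaken (by ring) (by linarith))
  add_comm f g := eq_of_near fun ε hε a v H => by
    refine f.isLocal (ε / 2) (by linarith) a v fun a₁ h₁ x hx => ?_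
    refine g.isLocal (ε / 2) (by linarith) a₁ v fun a₂ h₂ y hy => ?_
    have hx' := hx.mono h₂
    exact H a₂ (h₂.trans h₁) (x + y) ((near_add hx' hy).weaken rfl (by linarith))
      ((near_add hy hx').weaken (by ring) (by linarith))
  zero_add f := eq_of_near fun ε hε a v H =>
    f.isLocal ε hε a v fun a₁ h₁ x hx =>
      H a₁ h₁ x ((near_add (near_zero a₁ le_rfl) hx).weaken (by ring) (by linarith)) hx
  add_zero f := eq_of_near fun ε hε a v H =>
    f.isLocal ε hε a v fun a₁ h₁ x hx =>
      H a₁ h₁ x ((near_add hx (near_zero a₁ le_rfl)).weaken (by ring) (by linarith)) hx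
  neg_add_cancel f := eq_of_near fun ε hε a v H =>
    f.isLocal (ε / 2) (by linarith) a v fun a₁ h₁ x hx =>
      H a₁ h₁ 0 ((near_add (near_neg hx) hx).weaken (by ring) (by linarith))
        (near_zero a₁ hε.le)
  nsmul := nsmulRec
  zsmul := zsmulRec

noncomputable instance : Module ℝ (ContReal L) where
  one_smul f := eq_of_near fun ε hε a v H =>
    f.isLocal ε hε a v fun a₁ h₁ x hx =>
      H a₁ h₁ x ((near_smul 1 hx).weaken (by ring) (by simp)) hx
  mul_smul c d f := eq_of_near fun ε hε a v H => by
    have hcd : 0 < |c| * |d| + 1 := by positivity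
    refine f.isLocal (ε / (|c| * |d| + 1)) (by positivity) a v fun a₁ h₁ x hx => ?_
    have hle : |c| * |d| * (ε / (|c| * |d| + 1)) ≤ ε := by
      rw [mul_div_assoc', div_le_iff₀ hcd]; nlinarith
    exact H a₁ h₁ (c * d * x) ((near_smul (c * d) hx).weaken rfl (by rwa [abs_mul]))
      ((near_smul c (near_smul d hx)).weaken (by ring) (by rwa [← mul_assoc]))
  smul_zero c := eq_of_near fun ε hε a v H =>
    H a le_rfl 0 ((near_smul c (near_zero a le_rfl)).weaken (by ring) (by linarith))
      (near_zero a hε.le)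
  smul_add c f g := eq_of_near fun ε hε a v H => by
    have hc : 0 < 2 * |c| + 1 := by positivity
    have hle : |c| * (ε / (2 * |c| + 1) + ε / (2 * |c| + 1)) ≤ ε := by
      rw [← add_div, mul_div_assoc', div_le_iff₀ hc]; nlinarith
    refine f.isLocal (ε / (2 * |c| + 1)) (by positivity) a v fun a₁ h₁ x hx => ?_
    refine g.isLocal (ε / (2 * |c| + 1)) (by positivity) a₁ v fun a₂ h₂ y hy => ?_
    have hx' := hx.mono h₂
    exact H a₂ (h₂.trans h₁) (c * (x + y)) ((near_smul c (near_add hx' hy)).weaken rfl hle)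
      ((near_add (near_smul c hx') (near_smul c hy)).weaken (by ring) (by linarith))
  add_smul c d f := eq_of_near fun ε hε a v H => by
    have hcd : 0 < |c| + |d| + 1 := by positivity
    have hle : (|c| + |d|) * (ε / (|c| + |d| + 1)) ≤ ε := by
      rw [mul_div_assoc', div_le_iff₀ hcd]; nlinarith
    have hδ : 0 ≤ ε / (|c| + |d| + 1) := by positivity
    refine f.isLocal (ε / (|c| + |d| + 1)) (by positivity) a v fun a₁ h₁ x hx => ?_
    exact H a₁ h₁ ((c + d) * x)
      ((near_smul (c + d) hx).weaken rfl
        ((mul_le_mul_of_nonneg_right (abs_add_le c d) hδ).trans hle))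
      ((near_add (near_smul c hx) (near_smul d hx)).weaken (by ring) (by linarith))
  zero_smul f := eq_of_near fun ε hε a v H =>
    f.isLocal ε hε a v fun a₁ h₁ x hx =>
      H a₁ h₁ 0 ((near_smul 0 hx).weaken (by ring) (by simpa using hε.le)) (near_zero a₁ hε.le)

theorem gt_smul_rat {c : ℚ} (hc : 0 < c) (f : ContReal L) (p : ℚ) :
    ((c : ℝ) • f).gt p = f.gt (p / c) := by
  rw [gt_smul]
  apply le_antisymm
  · refine iSup₂_le fun i hi => inf_le_left.trans (f.gt_anti ?_)
    have h1 : p < c * i.1 := by exact_mod_cast hi.1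
    rw [div_le_iff₀ hc]
    linarith
  · refine f.gt_le_of_forall fun r hr => ?_
    rw [div_lt_iff₀ hc] at hr
    calc f.gt r = f.gt r ⊓ ⨆ s, f.lt s := by rw [f.r6, inf_top_eq]
      _ ≤ _ := by
        rw [inf_iSup_eq]
        refine iSup_le fun s => ?_
        refine le_iSup₂_of_le (r, max s r) ⟨?_, ?_⟩
          (inf_le_inf_left _ (f.lt_mono (le_max_left _ _)))
        · have : p < c * r := by linarith
          exact_mod_cast this
        · have : p < c * max s r :=
            lt_of_lt_of_le (by linarith) (mul_le_mul_of_nonneg_left (le_max_right s r) hc.le)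
          exact_mod_cast this

instance : IsOrderedAddMonoid (ContReal L) where
  add_le_add_left f g h k p := by
    rw [gt_add, gt_add]
    exact iSup_mono fun r => inf_le_inf_right _ (h r)

instance : IsOrderedModule ℝ (ContReal L) :=
  IsOrderedModule.of_smul_nonneg fun c hc f hf => by
    rw [le_iff_inf] at hf ⊢
    intro p
    refine le_bot_iff.1 ?_
    rw [gt_zero, lt_smul, iSup_inf_eq]
    refine iSup_le fun hp => ?_
    simp only [inf_iSup_eq]
    refine iSup₂_le fun i hi => ?_
    have hp' : (p : ℝ) < 0 := by exact_mod_cast hp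
    have h2 : i.2 < 0 := by
      by_contra h
      have : (0 : ℝ) ≤ i.2 := by exact_mod_cast not_lt.1 h
      nlinarith [hi.2, mul_nonneg hc this]
    refine inf_le_right.trans (inf_le_right.trans ?_)
    have := hf i.2
    rw [gt_zero, iSup_pos h2, top_inf_eq] at this
    exact this.le

/-- Composition with a frame homomorphism `h : L → M` as a map `C(L) → C(M)`. -/
def comp {M : Type*} [Order.Frame M] (h : FrameHom L M) (f : ContReal L) : ContReal M :=
  ⟨h.comp f.hom⟩

end ContReal

/-- `Υ : C(L) → C(𝔅(L))`, `f ↦ β ∘ f`. -/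
def upsilon (L : Type*) [Order.Frame L] : ContReal L → ContReal (Booleanization L) :=
  ContReal.comp (booleanizationHom L)

/-! ### Riesz spaces

A Riesz space is a real vector space `E` with a lattice order such that
`[IsOrderedAddMonoid E]` and `[IsOrderedModule ℝ E]`. -/

/-- Every nonempty subset that is bounded above has a supremum. -/
def IsDedekindComplete (E : Type*) [Lattice E] : Prop :=
  ∀ A : Set E, A.Nonempty → BddAbove A → ∃ s, IsLUB A s

/-- Every nonempty set of pairwise disjoint positive elements has a supremum. -/
def IsLaterallyComplete (E : Type*) [AddCommGroup E] [Lattice E] : Prop :=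
  ∀ A : Set E, A.Nonempty → (∀ f ∈ A, 0 ≤ f) → (∀ f ∈ A, ∀ g ∈ A, f ≠ g → f ⊓ g = 0) →
    ∃ s, IsLUB A s

/-- Universally complete: Dedekind complete and laterally complete. -/
def IsUniversallyComplete (E : Type*) [AddCommGroup E] [Lattice E] : Prop :=
  IsDedekindComplete E ∧ IsLaterallyComplete E

/-- An injective Riesz homomorphism, that is, an injective map that is both linear and a lattice
homomorphism. -/
structure IsRieszEmbedding {E F : Type*} [AddCommGroup E] [Module ℝ E] [Lattice E]
    [AddCommGroup F] [Module ℝ F] [Lattice F] (μ : E → F) : Prop where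
  map_add : ∀ f g, μ (f + g) = μ f + μ g
  map_smul : ∀ (c : ℝ) (f : E), μ (c • f) = c • μ f
  map_sup : ∀ f g, μ (f ⊔ g) = μ f ⊔ μ g
  map_inf : ∀ f g, μ (f ⊓ g) = μ f ⊓ μ g
  injective : Function.Injective μ

/-- `(F, μ)` is the universal completion of the Riesz space `E`. -/
structure IsUniversalCompletion {E F : Type*}
    [AddCommGroup E] [Module ℝ E] [Lattice E] [IsOrderedAddMonoid E] [IsOrderedModule ℝ E]
    [AddCommGroup F] [Module ℝ F] [Lattice F] [IsOrderedAddMonoid F] [IsOrderedModule ℝ F]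
    (μ : E → F) : Prop where
  universallyComplete : IsUniversallyComplete F
  embedding : IsRieszEmbedding μ
  isLUB : ∀ f : F, 0 ≤ f → IsLUB {h : F | ∃ g : E, h = μ g ∧ 0 ≤ μ g ∧ μ g ≤ f} f

/-! A real function on a frame is the same thing as a descending scale, a family `v p` indexed by
the rationals with `v q` rather below `v p` for `p < q`, whose members cover and whose complements
cover (`ofScale`).

In a complete Boolean algebra "rather below" is just `≤`, so every antitone family with join `⊤` and
meet `⊥` is a scale. The pointwise join of a nonempty set of functions is therefore a function as
soon as it is nowhere infinite (`exists_isLUB`). An upper bound keeps it finite, which gives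
Dedekind completeness. For pairwise disjoint functions it coincides with the single function `f` on
`f.gt 0`, and is finite there, which gives lateral completeness.

The operations of `C(L)` are built from finite meets and arbitrary joins, so composition with any
frame homomorphism preserves them. Since `f ≤ g` means that certain elements vanish (`le_iff_inf`),
a dense homomorphism such as `β` also reflects the order, hence is injective on functions.

For the approximation, let `0 ≤ p < t`. The element `f.gt t` is regular, and complete regularity
makes it in `L` a join of elements `b` completely below it. Urysohn's lemma
(`exists_of_completelyBelow`) gives a function that is `t` on `b`, vanishes off `f.gt t` and never
exceeds `t`; its image lies below `f` and is above `p` on `b`. These `b` exhaust `f.gt t`, and the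
`f.gt t` exhaust `f.gt p`. -/

theorem RatherBelow.le {L : Type*} [Order.Frame L] {a b : L} (h : RatherBelow b a) : b ≤ a := by
  calc b = b ⊓ (bᶜ ⊔ a) := by rw [show bᶜ ⊔ a = ⊤ from h, inf_top_eq]
    _ ≤ a := by rw [inf_sup_left, inf_compl_self, bot_sup_eq]; exact inf_le_right

/-- This is where Boolean algebras differ from general frames: excluded middle turns every antitone
family into a scale. -/
theorem ratherBelow_of_le {B : Type*} [CompleteBooleanAlgebra B] {a b : B} (h : b ≤ a) :
    RatherBelow b a :=
  top_le_iff.1 (compl_sup_eq_top.symm.le.trans (sup_le_sup_left h _))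

namespace ContReal

/-! ### Scales and Urysohn functions on a frame. -/

section Frame

variable {L M : Type*} [Order.Frame L] [Order.Frame M]

/-- The continuous real function with the descending scale `v`. -/
def ofScale (v : ℚ → L) (hv : ∀ p q, p < q → RatherBelow (v q) (v p))
    (htop : ⨆ p, v p = ⊤) (hbot : ⨆ p, (v p)ᶜ = ⊤) : ContReal L :=
  -- The family `v` itself need not be continuous in `p`. The joins over strict inequalities make it
  -- so, and the third and fourth relations then follow from the density of `ℚ`.
  ofGen (fun p => ⨆ q : ℚ, ⨆ _ : p < q, v q) (fun q => ⨆ p : ℚ, ⨆ _ : p < q, (v p)ᶜ)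
    (fun p q h => by
      refine le_bot_iff.1 ?_
      simp only [iSup_inf_eq, inf_iSup_eq]
      refine iSup₂_le fun i hi => iSup₂_le fun j hj => ?_
      exact (inf_le_inf_right _ (hv i j (hi.trans_le (h.trans hj.le))).le).trans_eq (inf_compl_self _))
    (fun p q h => by
      -- Two interpolants `p < r < s < q` are needed: both joins are over strict inequalities, and
      -- the scale relation compares only distinct indices.
      obtain ⟨r, hpr, hrq⟩ := exists_between h
      obtain ⟨s, hrs, hsq⟩ := exists_between hrq
      refine top_le_iff.1 ((hv r s hrs).symm.le.trans ?_)
      rw [sup_comm]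
      exact sup_le_sup (le_iSup₂_of_le r hpr le_rfl) (le_iSup₂_of_le s hsq le_rfl))
    (fun p => le_antisymm
      (iSup₂_le fun q hq => by
        obtain ⟨r, hpr, hrq⟩ := exists_between hq
        exact le_iSup₂_of_le r hpr (le_iSup₂_of_le q hrq le_rfl))
      (iSup₂_le fun q hq => iSup₂_le fun r hr => le_iSup₂_of_le r (hq.trans hr) le_rfl))
    (fun p => le_antisymm
      (iSup₂_le fun q hq => by
        obtain ⟨r, hqr, hrp⟩ := exists_between hq
        exact le_iSup₂_of_le r hrp (le_iSup₂_of_le q hqr le_rfl))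
      (iSup₂_le fun q hq => iSup₂_le fun r hr => le_iSup₂_of_le r (hr.trans hq) le_rfl))
    (top_le_iff.1 (htop.symm.le.trans
      (iSup_le fun p => le_iSup_of_le (p - 1) (le_iSup₂_of_le p (by linarith) le_rfl))))
    (top_le_iff.1 (hbot.symm.le.trans
      (iSup_le fun p => le_iSup_of_le (p + 1) (le_iSup₂_of_le p (by linarith) le_rfl))))

theorem gt_ofScale (v : ℚ → L) (hv htop hbot) (p : ℚ) :
    (ofScale v hv htop hbot).gt p = ⨆ q : ℚ, ⨆ _ : p < q, v q :=
  gt_ofGen _ _ _ _ _ _ _ _ _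

theorem gt_eq_top_of_nonneg {f : ContReal L} (hf : 0 ≤ f) {p : ℚ} (hp : p < 0) : f.gt p = ⊤ := by
  have h := hf p
  rw [gt_zero, iSup_pos hp] at h
  exact top_le_iff.1 h

/-- Urysohn's lemma: if `b` is completely below `a`, then some function with values in `[0, t]`
is `t` on `b` and vanishes off `a`. -/
theorem exists_of_completelyBelow {a b : L} (h : CompletelyBelow b a) {t : ℚ} (ht : 0 < t) :
    ∃ g : ContReal L, 0 ≤ g ∧ (∀ p, 0 ≤ p → g.gt p ≤ a) ∧ (∀ p, t ≤ p → g.gt p = ⊥) ∧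
      ∀ p, p < t → b ≤ g.gt p := by
  obtain ⟨c, hb, ha, hc⟩ := h
  -- The family `c` ascends while a scale descends, so `[0, 1]` is reversed and stretched to length
  -- `t`. The index `t` belongs to the middle range, so that `v t = c 0` is above `b`.
  let v : ℚ → L := fun p => if p ≤ 0 then ⊤ else if p ≤ t then c (1 - p / t) else ⊥
  have v_nonpos : ∀ p, p ≤ 0 → v p = ⊤ := fun p hp => if_pos hp
  have v_mid : ∀ p, 0 < p → p ≤ t → v p = c (1 - p / t) := fun p hp hpt => by
    simp only [v, if_neg hp.not_ge, if_pos hpt]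
  have v_big : ∀ p, t < p → v p = ⊥ := fun p hp => by
    simp only [v, if_neg (ht.trans hp).not_ge, if_neg hp.not_ge]
  have hv : ∀ p q, p < q → RatherBelow (v q) (v p) := by
    intro p q hpq
    rcases le_or_gt p 0 with hp | hp
    · rw [v_nonpos p hp]; exact sup_top_eq _
    rcases le_or_gt q t with hq | hq
    · rw [v_mid p hp (hpq.le.trans hq), v_mid q (hp.trans hpq) hq]
      refine hc _ _ ?_ ?_ ?_
      · rw [sub_nonneg, div_le_one ht]; exact hq
      · exact sub_lt_sub_left (div_lt_div_of_pos_right hpq ht) 1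
      · exact sub_le_self _ (by positivity)
    · rw [v_big q hq, RatherBelow, compl_bot, top_sup_eq]
  refine ⟨ofScale v hv ?_ ?_, ?_, ?_, ?_, ?_⟩
  · exact top_le_iff.1 (le_iSup_of_le 0 (v_nonpos 0 le_rfl).symm.le)
  · refine top_le_iff.1 (le_iSup_of_le (t + 1) ?_)
    rw [v_big _ (by linarith), compl_bot]
  · intro p
    rw [gt_zero, gt_ofScale]
    exact iSup_le fun hp => le_iSup₂_of_le 0 hp (v_nonpos 0 le_rfl).symm.le
  · intro p hp
    rw [gt_ofScale]
    refine iSup₂_le fun q hq => ?_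
    have hq0 : 0 < q := hp.trans_lt hq
    rcases le_or_gt q t with hqt | hqt
    · rw [v_mid q hq0 hqt]
      -- The value `c 1` is not taken by `v`, because `v 0 = ⊤`; but `q > 0` makes the index `1 - q
      -- / t` strictly less than `1`, so the witnessing relation still applies.
      refine (hc _ 1 ?_ ?_ le_rfl).le.trans ha
      · rw [sub_nonneg, div_le_one ht]; exact hqt
      · exact sub_lt_self _ (by positivity)
    · rw [v_big q hqt]; exact bot_le
  · intro p hp
    rw [gt_ofScale]
    refine le_bot_iff.1 (iSup₂_le fun q hq => ?_)
    rw [v_big q (hp.trans_lt hq)]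
  · intro p hp
    rw [gt_ofScale]
    refine le_iSup₂_of_le t hp ?_
    rw [v_mid t ht le_rfl, div_self ht.ne', sub_self]
    exact hb

/-! ### Composition with frame homomorphisms. -/

@[simp] theorem gt_comp (h : FrameHom L M) (f : ContReal L) (p : ℚ) :
    (f.comp h).gt p = h (f.gt p) := rfl

@[simp] theorem lt_comp (h : FrameHom L M) (f : ContReal L) (q : ℚ) :
    (f.comp h).lt q = h (f.lt q) := rfl

theorem comp_add (h : FrameHom L M) (f g : ContReal L) :
    (f + g).comp h = f.comp h + g.comp h :=
  ext_gen (fun p => by simp only [gt_comp, gt_add, map_iSup, map_inf])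
    (fun p => by simp only [lt_comp, lt_add, map_iSup, map_inf])

theorem comp_smul (h : FrameHom L M) (c : ℝ) (f : ContReal L) :
    (c • f).comp h = c • f.comp h :=
  ext_gen (fun p => by simp only [gt_comp, lt_comp, gt_smul, map_iSup, map_inf])
    (fun p => by simp only [gt_comp, lt_comp, lt_smul, map_iSup, map_inf])

theorem comp_sup (h : FrameHom L M) (f g : ContReal L) :
    (f ⊔ g).comp h = f.comp h ⊔ g.comp h :=
  ext_gen (fun p => by simp only [gt_comp, gt_sup, map_sup])
    (fun p => by simp only [lt_comp, lt_sup, map_inf])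

theorem comp_inf (h : FrameHom L M) (f g : ContReal L) :
    (f ⊓ g).comp h = f.comp h ⊓ g.comp h :=
  ext_gen (fun p => by simp only [gt_comp, gt_inf, map_inf])
    (fun p => by simp only [lt_comp, lt_inf, map_sup])

theorem comp_mono (h : FrameHom L M) {f g : ContReal L} (hfg : f ≤ g) : f.comp h ≤ g.comp h :=
  fun p => OrderHomClass.mono h (hfg p)

theorem comp_zero (h : FrameHom L M) : (0 : ContReal L).comp h = 0 :=
  ext_gen (fun p => by simp only [gt_comp, gt_zero, map_iSup, map_top])
    (fun p => by simp only [lt_comp, lt_zero, map_iSup, map_top])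

/-- Composition with a dense frame homomorphism reflects the order. -/
theorem le_of_comp_le {h : FrameHom L M} (hd : ∀ a, h a = ⊥ → a = ⊥) {f g : ContReal L}
    (hfg : f.comp h ≤ g.comp h) : f ≤ g :=
  -- `le_iff_inf` expresses the order by the vanishing of elements, which is exactly what density
  -- detects.
  le_iff_inf.2 fun p => hd _ (by
    rw [map_inf]
    exact le_iff_inf.1 hfg p)

theorem comp_injective {h : FrameHom L M} (hd : ∀ a, h a = ⊥ → a = ⊥) :
    Function.Injective (comp h) :=
  fun _ _ e => le_antisymm (le_of_comp_le hd e.le) (le_of_comp_le hd e.ge)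

end Frame

/-! ### Universal completeness over a complete Boolean algebra. -/

section Boolean

variable {B : Type*} [CompleteBooleanAlgebra B]

/-- Finiteness of `f` from above: the `f.lt p` cover and lie below the complements of the `f.gt p`,
and De Morgan's law for infinite meets turns this cover into a vanishing meet. -/
theorem iInf_gt_eq_bot (f : ContReal B) : ⨅ p, f.gt p = ⊥ := by
  refine compl_eq_top.1 (top_le_iff.1 ?_)
  rw [compl_iInf, ← f.r6]
  exact iSup_mono fun p => le_compl_iff_disjoint_left.2 (disjoint_iff.2 (f.r1 le_rfl))

/-- A set of functions with values in a complete Boolean algebra has a supremum if the pointwise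
supremum takes no infinite value. -/
theorem exists_isLUB {A : Set (ContReal B)} (hA : A.Nonempty)
    (h : ⨅ p, ⨆ f ∈ A, f.gt p = ⊥) : ∃ s, IsLUB A s := by
  let v : ℚ → B := fun p => ⨆ f ∈ A, f.gt p
  have hv : ∀ p q, p < q → RatherBelow (v q) (v p) := fun p q hpq =>
    ratherBelow_of_le (iSup₂_mono fun f _ => f.gt_anti hpq.le)
  -- Finiteness from below is inherited from a single member of `A`.
  have htop : ⨆ p, v p = ⊤ := by
    obtain ⟨f, hf⟩ := hA
    rw [← top_le_iff, ← f.r5]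
    exact iSup_mono fun p => le_iSup₂_of_le f hf le_rfl
  have hbot : ⨆ p, (v p)ᶜ = ⊤ := by rw [← compl_iInf, h, compl_bot]
  refine ⟨ofScale v hv htop hbot, fun f hf p => ?_, fun k hk p => ?_⟩
  · rw [gt_ofScale]
    exact f.gt_le_of_forall fun q hq => le_iSup₂_of_le q hq (le_iSup₂_of_le f hf le_rfl)
  · rw [gt_ofScale]
    exact iSup₂_le fun q hq => iSup₂_le fun f hf => (hk hf q).trans (k.gt_anti hq.le)

theorem isDedekindComplete : IsDedekindComplete (ContReal B) := by
  rintro A hA ⟨k, hk⟩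
  refine exists_isLUB hA (le_bot_iff.1 ?_)
  rw [← k.iInf_gt_eq_bot]
  exact iInf_mono fun p => iSup₂_le fun f hf => hk hf p

/-- The place where the pointwise supremum is infinite lies under the join of the supports `f.gt 0`.
On each support the other members of the set are not positive, so the supremum is the finite
function `f`. -/
theorem isLaterallyComplete : IsLaterallyComplete (ContReal B) := by
  intro A hA _ hdisj
  refine exists_isLUB hA (le_bot_iff.1 ?_)
  have key : ∀ f ∈ A, (⨅ p, ⨆ g ∈ A, g.gt p) ⊓ f.gt 0 ≤ ⊥ := by
    intro f hf
    rw [← f.iInf_gt_eq_bot]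
    refine le_iInf fun p => ?_
    rcases lt_or_ge p 0 with hp | hp
    · exact inf_le_right.trans (f.gt_anti hp.le)
    · refine (inf_le_inf_right _ (iInf_le _ p)).trans ?_
      simp only [iSup_inf_eq]
      refine iSup₂_le fun g hg => ?_
      by_cases e : g = f
      · subst e; exact inf_le_left
      -- As `p ≥ 0`, the part where `g` exceeds `p` lies in the support of `g`, which is disjoint
      -- from that of `f`.
      · refine (inf_le_inf_right _ (g.gt_anti hp)).trans ?_
        rw [← gt_inf, hdisj g hg f hf e, gt_zero]
        exact iSup_le fun h => absurd h (lt_irrefl 0)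
  calc (⨅ p, ⨆ g ∈ A, g.gt p)
      = (⨅ p, ⨆ g ∈ A, g.gt p) ⊓ ⨆ f ∈ A, f.gt 0 := (inf_eq_left.2 (iInf_le _ 0)).symm
    _ ≤ ⊥ := by
      simp only [inf_iSup_eq]
      exact iSup₂_le key

end Boolean

end ContReal

/-! ### The embedding into the Booleanization and its order density. -/

section Booleanization

variable {L : Type*} [Order.Frame L]

theorem booleanizationHom_dense (a : L) (h : booleanizationHom L a = ⊥) : a = ⊥ := by
  have h' : aᶜᶜ = ⊥ := congrArg Heyting.Regular.val h
  exact le_bot_iff.1 (le_compl_compl.trans_eq h')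

/-- Regular elements are fixed by `β`, so a join decomposition found in `L` can be carried over to
the Booleanization. -/
theorem booleanizationHom_val (a : Booleanization L) :
    booleanizationHom L (Heyting.Regular.val a) = a :=
  Heyting.Regular.coe_injective a.prop

theorem isRieszEmbedding_upsilon : IsRieszEmbedding (upsilon L) where
  map_add := ContReal.comp_add _
  map_smul := ContReal.comp_smul _
  map_sup := ContReal.comp_sup _
  map_inf := ContReal.comp_inf _
  injective := ContReal.comp_injective booleanizationHom_dense

theorem isLUB_upsilon (hL : IsCompletelyRegularFrame L) {f : ContReal (Booleanization L)}
    (hf : 0 ≤ f) :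
    IsLUB {h | ∃ g : ContReal L, h = upsilon L g ∧ 0 ≤ upsilon L g ∧ upsilon L g ≤ f} f := by
  constructor
  · rintro _ ⟨g, rfl, _, hg⟩
    exact hg
  intro k hk
  -- The zero function is one of the approximants; this settles the negative values of `p`.
  have hk0 : 0 ≤ k := by
    refine hk ⟨0, ?_⟩
    rw [upsilon, ContReal.comp_zero]
    exact ⟨rfl, le_rfl, hf⟩
  intro p
  rcases lt_or_ge p 0 with hp | hp
  · rw [ContReal.gt_eq_top_of_nonneg hk0 hp]
    exact le_top
  -- The gap between `p` and `t` is needed because a function bounded by `t` exceeds only levels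
  -- strictly below `t`.
  refine f.gt_le_of_forall fun t hpt => ?_
  have ht : 0 < t := hp.trans_lt hpt
  rw [← booleanizationHom_val (f.gt t), hL (Heyting.Regular.val (f.gt t)), map_sSup]
  refine sSup_le ?_
  rintro _ ⟨b, hb, rfl⟩
  obtain ⟨g, hg0, hga, hgt, hgb⟩ := ContReal.exists_of_completelyBelow hb ht
  -- Below level `0` the function `f` is everywhere larger; from `0` up to `t` the image of `g`
  -- lives inside `f.gt t`; from `t` on, `g` has nothing left.
  have hg : upsilon L g ≤ f := by
    intro r
    rcases lt_or_ge r 0 with hr | hr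
    · rw [ContReal.gt_eq_top_of_nonneg hf hr]
      exact le_top
    rcases le_or_gt t r with htr | htr
    · rw [upsilon, ContReal.gt_comp, hgt r htr, map_bot]
      exact bot_le
    · refine (OrderHomClass.mono (booleanizationHom L) (hga r hr)).trans ?_
      rw [booleanizationHom_val]
      exact f.gt_anti htr.le
  have hg0' : 0 ≤ upsilon L g := by
    rw [← ContReal.comp_zero (booleanizationHom L)]
    exact ContReal.comp_mono _ hg0
  exact (OrderHomClass.mono (booleanizationHom L) (hgb p hpt)).trans
    (hk ⟨g, rfl, hg0', hg⟩ p)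

end Booleanization

theorem mainTheorem1 {L : Type*} [Order.Frame L] (hL : IsCompletelyRegularFrame L) :
    IsUniversalCompletion (upsilon L) where
  universallyComplete := ⟨ContReal.isDedekindComplete, ContReal.isLaterallyComplete⟩
  embedding := isRieszEmbedding_upsilon
  isLUB _ hf := isLUB_upsilon hL hf
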